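/- **Theorem.** For $n\ge 0$, let $\mathfrak{D}^4_{2n}$ be the set of Dumont permutations of the fourth kind of size $2n$, that is, of permutations $\pi$ of $\{1,\dots,2n\}$ such that $\pi(i)<i$ implies that $i$ and $\pi(i)$ are both even, and let $\mathfrak{D}^4_{2n}(\tau)$ be the set of those that avoid the pattern $\tau$. For $k\ge 0$ and odd $n\ge 1$, let $r_{k,n}$ be the number of permutations $\pi$ of $\{1,\dots,n\}$ that avoid the pattern $312$ and are such that, for every $i$, $i-\pi(i)\ge 2k+1$ implies that $i$ and $\pi(i)$ are both even; let $R_{2k+1}=R_{2k+1}(z)=\sum_{n\text{ odd}} r_{k,n}z^n\in\mathbb{Q}[[z]]$. With the Catalan numbers $C_i=\frac{1}{i+1}\binom{2i}{i}$, put $$C_{e,2k}=\sum_{i=0}^{k}C_{2i}z^{2i},\qquad C_{o,2k-1}=\sum_{i=0}^{k-1}C_{2i+1}z^{2i+1}\qquad(k\ge 0),$$ so that $C_{o,-1}=0$. Then $\mathfrak{D}^4_{2n}(1423)=\mathfrak{D}^4_{2n}(312)$ for all $n\ge 0$, and the ordinary generating function $\sum_{n\ge 0}|\mathfrak{D}^4_{2n}(1423)|\,z^n$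 is $(R_1/z)\circ\sqrt z$; that is, $R_1(z)=z\sum_{n\ge 0}|\mathfrak{D}^4_{2n}(1423)|\,z^{2n}$. Moreover, for all $k\ge 0$, $$zR_{2k+1}=\cfrac{z^2C_{e,2k}}{(1-zC_{o,2k-1})^2-\cfrac{z^2C_{e,2k}}{1-zC_{o,2k+1}-\cfrac{z^2C_{e,2k}^2}{1-zR_{2k+3}}}}$$ as formal power series, and $(R_{2k+1})_{k\ge 0}$ is the only sequence in $\mathbb{Q}[[z]]$ that satisfies this recurrence for all $k\ge 0$. -/

import Mathlib

open PowerSeries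

noncomputable section

namespace Dumont

/-- The permutation `π` of size `N` contains the pattern given by the word `τ` (written with
distinct letters): there are positions `f 0 < f 1 < ⋯ < f (r - 1)` at which the entries of `π`
are in the same relative order as the letters of `τ`. -/
def Contains {N r : ℕ} (π : Equiv.Perm (Fin N)) (τ : Fin r → ℕ) : Prop :=
  ∃ f : Fin r → Fin N, StrictMono f ∧ ∀ a b : Fin r, τ a < τ b ↔ π (f a) < π (f b)

/-- The one-based position of the index `i`. -/
def pos {N : ℕ} (i : Fin N) : ℕ := i.val + 1

/-- The one-based value of the entry of `π` in the position of index `i`. -/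
def val {N : ℕ} (π : Equiv.Perm (Fin N)) (i : Fin N) : ℕ := (π i).val + 1

/-- Dumont permutations of the fourth kind of size `2 * n`: every deficiency is an even value at
an even position. -/
def IsDumont4 {n : ℕ} (π : Equiv.Perm (Fin (2 * n))) : Prop :=
  ∀ i, val π i < pos i → Even (pos i) ∧ Even (val π i)

/-- The set of Dumont permutations of the fourth kind of size `2 * n` that avoid `τ`. -/
def dumont4Avoiding (n : ℕ) {r : ℕ} (τ : Fin r → ℕ) : Set (Equiv.Perm (Fin (2 * n))) :=
  {π | IsDumont4 π ∧ ¬ Contains π τ}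

/-- The ordinary generating function of the number of Dumont permutations of the fourth kind of
size `2 * n` that avoid `τ`. -/
def dumont4Series {r : ℕ} (τ : Fin r → ℕ) : PowerSeries ℚ :=
  PowerSeries.mk fun n => ((dumont4Avoiding n τ).ncard : ℚ)

/-- The permutations of size `N` that fit on the `R`-board of dimension `N` with parameter `m`:
the cell in column `p` and row `v` (both numbered from one) is always allowed if `p - v < m`, and
if `p - v ≥ m`, then it is allowed exactly when `p` and `v` are both even. For odd `m`, the first
`m` cells are then the maximal initial segment of allowed cells in the bottom row. -/
def FitsRBoard (m : ℕ) {N : ℕ} (π : Equiv.Perm (Fin N)) : Prop :=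
  ∀ i, val π i + m ≤ pos i → Even (pos i) ∧ Even (val π i)

/-- The generating function `R_m`, for odd `m`, of the permutations avoiding `312` on the
`R`-boards with parameter `m`. The dimensions of these boards are the odd numbers. -/
def rSeries (m : ℕ) : PowerSeries ℚ :=
  PowerSeries.mk fun N =>
    if Odd N then
      (({π : Equiv.Perm (Fin N) | FitsRBoard m π ∧ ¬ Contains π ![3, 1, 2]}.ncard : ℕ) : ℚ)
    else 0

/-- The truncation `C_{e,2k}` of the even part of the Catalan generating function: the sum of
`C_{2i} z^{2i}` over `0 ≤ i ≤ k`. -/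
def catE (k : ℕ) : PowerSeries ℚ :=
  ∑ i ∈ Finset.range (k + 1), (catalan (2 * i) : PowerSeries ℚ) * X ^ (2 * i)

/-- The truncation `C_{o,2k-1}` of the odd part of the Catalan generating function: the sum of
`C_{2i+1} z^{2i+1}` over `0 ≤ i ≤ k - 1`; it is zero for `k = 0`. -/
def catO (k : ℕ) : PowerSeries ℚ :=
  ∑ i ∈ Finset.range k, (catalan (2 * i + 1) : PowerSeries ℚ) * X ^ (2 * i + 1)

/-- The continued-fraction recurrence, for a sequence of formal power series `F k`, in the role of
`R_{2k+1}`. Each series that is inverted here has constant coefficient one, so that every `⁻¹` is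
the true inverse of a formal power series, whatever the sequence `F` is. -/
def SatisfiesRecurrence (F : ℕ → PowerSeries ℚ) : Prop :=
  ∀ k, X * F k =
    X ^ 2 * catE k *
      ((1 - X * catO k) ^ 2 -
        X ^ 2 * catE k *
          (1 - X * catO (k + 1) -
            X ^ 2 * catE k ^ 2 *
              (1 - X * F (k + 1))⁻¹)⁻¹)⁻¹

end Dumont

end

namespace Dumont

/-! A Dumont permutation of the fourth kind starts with its smallest entry, which completes any 312
to a 1423; so both patterns define the same set.

For the counting, a 312-avoider with its smallest entry in position `a + 1` is `(σ + 1) 1 (τ + a +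
1)` with `σ`, `τ` arbitrary 312-avoiders (`exists_glue_eq`, `contains_glue_iff`). On a board `board
m s t`, the block `σ` sees the parameter `m + 1` and the other parity of rows, while `τ` sees the
same `m` with both parities shifted by `a + 1`. Sorting by the parities of the size and of `a` gives
linear equations (`partSeries_board`). Where the entry 1 cannot lie beyond the first `m` cells, `σ`
is too short to be restricted, whence the truncated Catalan series. Otherwise `σ` contributes the
series of a new board; two such steps lead from the parameter `2k + 1` to `2k + 3`, and elimination
yields the continued fraction.

The recurrence is contracting in the `X`-adic sense, hence has one solution. For `k = 0`, the odd
part and `X` times the even part of the same board solve the same linear equation, which identifies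
`R_1`. -/

/-! ### Pattern containment, and 1423 versus 312. -/

theorem contains_312_iff {N : ℕ} (π : Equiv.Perm (Fin N)) :
    Contains π ![3, 1, 2] ↔ ∃ i j k, i < j ∧ j < k ∧ π j < π k ∧ π k < π i := by
  constructor
  · rintro ⟨f, hf, h⟩
    refine ⟨f 0, f 1, f 2, hf (by decide), hf (by decide), (h 1 2).1 (by simp), (h 2 0).1 (by simp)⟩
  · rintro ⟨i, j, k, hij, hjk, h1, h2⟩
    refine ⟨![i, j, k], ?_, ?_⟩
    · rw [Fin.strictMono_iff_lt_succ]
      intro a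
      fin_cases a
      · exact hij
      · exact hjk
    · intro a b
      fin_cases a <;> fin_cases b <;> simp <;> order

theorem contains_1423_iff {N : ℕ} (π : Equiv.Perm (Fin N)) :
    Contains π ![1, 4, 2, 3] ↔ ∃ h i j k, h < i ∧ i < j ∧ j < k ∧
      π h < π j ∧ π j < π k ∧ π k < π i := by
  constructor
  · rintro ⟨f, hf, h⟩
    exact ⟨f 0, f 1, f 2, f 3, hf (by decide), hf (by decide), hf (by decide),
      (h 0 2).1 (by simp), (h 2 3).1 (by simp), (h 3 1).1 (by simp)⟩
  · rintro ⟨h, i, j, k, hhi, hij, hjk, h0, h1, h2⟩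
    refine ⟨![h, i, j, k], ?_, ?_⟩
    · rw [Fin.strictMono_iff_lt_succ]
      intro a
      fin_cases a
      · exact hhi
      · exact hij
      · exact hjk
    · intro a b
      fin_cases a <;> fin_cases b <;> simp <;> order

/-- In a Dumont permutation of the fourth kind, the first entry is the smallest one. -/
theorem IsDumont4.first {n : ℕ} {π : Equiv.Perm (Fin (2 * n))} (h : IsDumont4 π)
    (h0 : 0 < 2 * n) : π ⟨0, h0⟩ = ⟨0, h0⟩ := by
  by_contra hne
  have h1 : π (π.symm ⟨0, h0⟩) = ⟨0, h0⟩ := by simp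
  have h2 : π.symm ⟨0, h0⟩ ≠ ⟨0, h0⟩ := by
    intro h3
    rw [h3] at h1
    exact hne h1
  have h3 := h (π.symm ⟨0, h0⟩)
  simp only [val, pos, h1] at h3
  have h4 : (π.symm ⟨0, h0⟩).val ≠ 0 := fun h5 => h2 (Fin.ext h5)
  have h5 := (h3 (by omega)).2
  simp at h5

theorem dumont4Avoiding_1423_eq (n : ℕ) :
    dumont4Avoiding n ![1, 4, 2, 3] = dumont4Avoiding n ![3, 1, 2] := by
  ext π
  simp only [dumont4Avoiding, Set.mem_ofPred_eq, contains_312_iff, contains_1423_iff]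
  refine and_congr_right fun hD => not_congr ?_
  constructor
  · rintro ⟨h, i, j, k, -, hij, hjk, -, h1, h2⟩
    exact ⟨i, j, k, hij, hjk, h1, h2⟩
  · rintro ⟨i, j, k, hij, hjk, h1, h2⟩
    have hn : 0 < 2 * n := i.pos
    have hf := hD.first hn
    have hi : i ≠ ⟨0, hn⟩ := by
      rintro rfl
      rw [hf] at h2
      exact absurd h2 (by simp [Fin.lt_def])
    have hj : π j ≠ ⟨0, hn⟩ := by
      rw [← hf]
      intro h3
      rw [π.injective h3] at hij
      exact absurd hij (by simp [Fin.lt_def])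
    refine ⟨⟨0, hn⟩, i, j, k, ?_, hij, hjk, ?_, h1, h2⟩
    · exact Fin.lt_def.2 (Nat.pos_of_ne_zero fun h => hi (Fin.ext h))
    · rw [hf]
      exact Fin.lt_def.2 (Nat.pos_of_ne_zero fun h => hj (Fin.ext h))

/-! ### Decomposition of 312-avoiders around the entry 1. -/

/-- The `312`-avoiding permutations of size `N` all of whose cells (position, value), both numbered
from one, are allowed by `P`. -/
def avoiders (P : ℕ → ℕ → Prop) (N : ℕ) : Set (Equiv.Perm (Fin N)) :=
  {π | (∀ i, P (pos i) (val π i)) ∧ ¬ Contains π ![3, 1, 2]}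

/-- The number of `312`-avoiding permutations of size `N` on the board `P`. -/
noncomputable def cnt (P : ℕ → ℕ → Prop) (N : ℕ) : ℕ := (avoiders P N).ncard

theorem cnt_congr {P Q : ℕ → ℕ → Prop} {N : ℕ}
    (h : ∀ p v, 1 ≤ p → p ≤ N → 1 ≤ v → v ≤ N → (P p v ↔ Q p v)) : cnt P N = cnt Q N := by
  unfold cnt
  congr 1
  ext π
  refine and_congr_left fun _ => forall_congr' fun i => ?_
  have h1 := i.isLt
  have h2 := (π i).isLt
  exact h _ _ (by simp [pos]) (by simp only [pos]; omega) (by simp [val])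
    (by simp only [val]; omega)

theorem cnt_zero (P : ℕ → ℕ → Prop) : cnt P 0 = 1 := by
  have : avoiders P 0 = {1} := by
    ext π
    simp only [avoiders, Set.mem_ofPred_eq, Set.mem_singleton_iff, contains_312_iff]
    refine ⟨fun _ => Subsingleton.elim _ _, fun _ => ⟨fun i => i.elim0, ?_⟩⟩
    rintro ⟨i, -⟩
    exact i.elim0
  rw [cnt, this, Set.ncard_singleton]

/-- The word of the permutation `(σ + 1) 1 (τ + a + 1)`, numbered from zero. -/
def glueFun {a b : ℕ} (σ : Equiv.Perm (Fin a)) (τ : Equiv.Perm (Fin b)) (i : Fin (a + 1 + b)) :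
    Fin (a + 1 + b) :=
  if h : i.val < a then ⟨(σ ⟨i, h⟩).val + 1, by have := (σ ⟨i, h⟩).isLt; omega⟩
  else if h' : i.val = a then ⟨0, by omega⟩
  else ⟨(τ ⟨i.val - (a + 1), by omega⟩).val + (a + 1), by
    have := (τ ⟨i.val - (a + 1), by omega⟩).isLt; omega⟩

theorem glueFun_left {a b : ℕ} (σ : Equiv.Perm (Fin a)) (τ : Equiv.Perm (Fin b))
    {i : Fin (a + 1 + b)} (j : Fin a) (h : i.val = j.val) :
    (glueFun σ τ i).val = (σ j).val + 1 := by
  have hj := j.isLt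
  have : (⟨i.val, h ▸ hj⟩ : Fin a) = j := Fin.ext h
  rw [glueFun, dif_pos (h ▸ hj)]
  simp only [this]

theorem glueFun_mid {a b : ℕ} (σ : Equiv.Perm (Fin a)) (τ : Equiv.Perm (Fin b))
    {i : Fin (a + 1 + b)} (h : i.val = a) : (glueFun σ τ i).val = 0 := by
  rw [glueFun, dif_neg (by omega), dif_pos h]

theorem glueFun_right {a b : ℕ} (σ : Equiv.Perm (Fin a)) (τ : Equiv.Perm (Fin b))
    {i : Fin (a + 1 + b)} (j : Fin b) (h : i.val = j.val + (a + 1)) :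
    (glueFun σ τ i).val = (τ j).val + (a + 1) := by
  have : (⟨i.val - (a + 1), by omega⟩ : Fin b) = j := Fin.ext (by simp only; omega)
  rw [glueFun, dif_neg (by omega), dif_neg (by omega)]
  simp only [this]

/-- A position of `(σ + 1) 1 (τ + a + 1)` lies in exactly one of three blocks. -/
theorem position_cases {a b : ℕ} (i : Fin (a + 1 + b)) :
    (∃ j : Fin a, i.val = j.val) ∨ i.val = a ∨ ∃ j : Fin b, i.val = j.val + (a + 1) := by
  rcases lt_trichotomy i.val a with h | h | h
  · exact Or.inl ⟨⟨i, h⟩, rfl⟩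
  · exact Or.inr (Or.inl h)
  · exact Or.inr (Or.inr ⟨⟨i.val - (a + 1), by omega⟩, by simp only; omega⟩)

theorem glueFun_cases {a b : ℕ} (σ : Equiv.Perm (Fin a)) (τ : Equiv.Perm (Fin b))
    (i : Fin (a + 1 + b)) :
    (∃ j : Fin a, i.val = j.val ∧ (glueFun σ τ i).val = (σ j).val + 1) ∨
      (i.val = a ∧ (glueFun σ τ i).val = 0) ∨
      ∃ j : Fin b, i.val = j.val + (a + 1) ∧ (glueFun σ τ i).val = (τ j).val + (a + 1) := by
  rcases position_cases i with ⟨j, hj⟩ | hj | ⟨j, hj⟩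
  · exact Or.inl ⟨j, hj, glueFun_left σ τ j hj⟩
  · exact Or.inr (Or.inl ⟨hj, glueFun_mid σ τ hj⟩)
  · exact Or.inr (Or.inr ⟨j, hj, glueFun_right σ τ j hj⟩)

theorem glueFun_injective {a b : ℕ} (σ : Equiv.Perm (Fin a)) (τ : Equiv.Perm (Fin b)) :
    Function.Injective (glueFun σ τ) := by
  intro i i' h
  have h' : (glueFun σ τ i).val = (glueFun σ τ i').val := by rw [h]
  rcases glueFun_cases σ τ i with ⟨j, hj, hv⟩ | ⟨hj, hv⟩ | ⟨j, hj, hv⟩ <;>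
  rcases glueFun_cases σ τ i' with ⟨j', hj', hv'⟩ | ⟨hj', hv'⟩ | ⟨j', hj', hv'⟩ <;>
  rw [hv, hv'] at h'
  · have : j = j' := σ.injective (Fin.ext (by omega))
    exact Fin.ext (by rw [hj, hj', this])
  · omega
  · have := (σ j).isLt
    omega
  · omega
  · exact Fin.ext (by omega)
  · omega
  · have := (σ j').isLt
    omega
  · omega
  · have : j = j' := τ.injective (Fin.ext (by omega))
    exact Fin.ext (by rw [hj, hj', this])

/-- The permutation `(σ + 1) 1 (τ + a + 1)`. -/
noncomputable def glue {a b : ℕ} (σ : Equiv.Perm (Fin a)) (τ : Equiv.Perm (Fin b)) :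
    Equiv.Perm (Fin (a + 1 + b)) :=
  Equiv.ofBijective (glueFun σ τ) (Finite.injective_iff_bijective.1 (glueFun_injective σ τ))

theorem glue_left {a b : ℕ} (σ : Equiv.Perm (Fin a)) (τ : Equiv.Perm (Fin b))
    {i : Fin (a + 1 + b)} (j : Fin a) (h : i.val = j.val) :
    (glue σ τ i).val = (σ j).val + 1 := glueFun_left σ τ j h

theorem glue_mid {a b : ℕ} (σ : Equiv.Perm (Fin a)) (τ : Equiv.Perm (Fin b))
    {i : Fin (a + 1 + b)} (h : i.val = a) : (glue σ τ i).val = 0 := glueFun_mid σ τ h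

theorem glue_right {a b : ℕ} (σ : Equiv.Perm (Fin a)) (τ : Equiv.Perm (Fin b))
    {i : Fin (a + 1 + b)} (j : Fin b) (h : i.val = j.val + (a + 1)) :
    (glue σ τ i).val = (τ j).val + (a + 1) := glueFun_right σ τ j h

theorem glue_injective {a b : ℕ} {σ σ' : Equiv.Perm (Fin a)} {τ τ' : Equiv.Perm (Fin b)}
    (h : glue σ τ = glue σ' τ') : σ = σ' ∧ τ = τ' := by
  constructor
  · ext j
    have h1 := glue_left σ τ (i := ⟨j, by omega⟩) j rfl
    rw [h, glue_left σ' τ' (i := ⟨j, by omega⟩) j rfl] at h1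
    omega
  · ext j
    have h1 := glue_right σ τ (i := ⟨j + (a + 1), by omega⟩) j rfl
    rw [h, glue_right σ' τ' (i := ⟨j + (a + 1), by omega⟩) j rfl] at h1
    omega

theorem contains_glue_iff {a b : ℕ} (σ : Equiv.Perm (Fin a)) (τ : Equiv.Perm (Fin b)) :
    Contains (glue σ τ) ![3, 1, 2] ↔ Contains σ ![3, 1, 2] ∨ Contains τ ![3, 1, 2] := by
  simp only [contains_312_iff]
  constructor
  · rintro ⟨i, j, k, hij, hjk, h1, h2⟩
    simp only [Fin.lt_def] at hij hjk h1 h2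
    -- The last letter of a 312 decides: it is not the minimum, and if it lies in the right block,
    -- so does the larger "3", hence the whole occurrence.
    rcases position_cases k with ⟨k', hk⟩ | hk | ⟨k', hk⟩
    · have hk' := k'.isLt
      rw [glue_left σ τ _ hk] at h1 h2
      rw [glue_left σ τ ⟨j, by omega⟩ rfl] at h1
      rw [glue_left σ τ ⟨i, by omega⟩ rfl] at h2
      refine Or.inl ⟨⟨i, by omega⟩, ⟨j, by omega⟩, k', ?_, ?_, ?_, ?_⟩ <;>
        simp only [Fin.lt_def] <;> omega
    · rw [glue_mid σ τ hk] at h1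
      omega
    · rw [glue_right σ τ _ hk] at h1 h2
      rcases position_cases i with ⟨i', hi⟩ | hi | ⟨i', hi⟩
      · rw [glue_left σ τ _ hi] at h2
        have := (σ i').isLt
        omega
      · rw [glue_mid σ τ hi] at h2
        omega
      · rw [glue_right σ τ _ hi] at h2
        rw [glue_right σ τ ⟨j - (a + 1), by omega⟩ (by simp only; omega)] at h1
        refine Or.inr ⟨i', ⟨j - (a + 1), by omega⟩, k', ?_, ?_, ?_, ?_⟩ <;>
          simp only [Fin.lt_def] <;> omega
  · rintro (⟨i, j, k, hij, hjk, h1, h2⟩ | ⟨i, j, k, hij, hjk, h1, h2⟩)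
    · refine ⟨⟨i, by omega⟩, ⟨j, by omega⟩, ⟨k, by omega⟩, hij, hjk, ?_, ?_⟩ <;>
        simp only [Fin.lt_def] at h1 h2 ⊢
      · rw [glue_left σ τ j rfl, glue_left σ τ k rfl]
        omega
      · rw [glue_left σ τ k rfl, glue_left σ τ i rfl]
        omega
    · simp only [Fin.lt_def] at hij hjk h1 h2
      refine ⟨⟨i + (a + 1), by omega⟩, ⟨j + (a + 1), by omega⟩, ⟨k + (a + 1), by omega⟩, ?_, ?_,
        ?_, ?_⟩ <;> simp only [Fin.lt_def]
      · omega
      · omega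
      · rw [glue_right σ τ j rfl, glue_right σ τ k rfl]
        omega
      · rw [glue_right σ τ k rfl, glue_right σ τ i rfl]
        omega

theorem fits_glue_iff {a b : ℕ} (P : ℕ → ℕ → Prop) (σ : Equiv.Perm (Fin a))
    (τ : Equiv.Perm (Fin b)) :
    (∀ i, P (pos i) (val (glue σ τ) i)) ↔ (∀ i, P (pos i) (val σ i + 1)) ∧ P (a + 1) 1 ∧
      ∀ i, P (pos i + (a + 1)) (val τ i + (a + 1)) := by
  simp only [pos, val]
  constructor
  · intro h
    refine ⟨fun i => ?_, ?_, fun i => ?_⟩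
    · have := h ⟨i, by omega⟩
      rwa [glue_left σ τ i rfl] at this
    · have := h ⟨a, by omega⟩
      rwa [glue_mid σ τ rfl] at this
    · have := h ⟨i + (a + 1), by omega⟩
      rw [glue_right σ τ i rfl] at this
      convert this using 1 <;> ring
  · rintro ⟨h1, h2, h3⟩ i
    rcases position_cases i with ⟨j, hj⟩ | hj | ⟨j, hj⟩
    · rw [glue_left σ τ _ hj, hj]
      exact h1 j
    · rw [glue_mid σ τ hj, hj]
      exact h2
    · rw [glue_right σ τ _ hj, hj]
      convert h3 j using 1 <;> ring

theorem le_of_injective_of_lt {b c : ℕ} (f : Fin b → ℕ) (hf : Function.Injective f)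
    (h : ∀ i, f i < c) : b ≤ c := by
  have := Finset.card_le_card_of_injOn (s := Finset.univ) (t := Finset.range c) f
    (fun i _ => Finset.mem_coe.2 (Finset.mem_range.2 (h i))) hf.injOn
  simpa using this

/-- An entry before the minimum that exceeds one after it would form a 312 with the minimum. So the
first `a + 1` entries lie below the last `b`, and counting pins down the two sets of values. -/
theorem exists_glue_eq {a b : ℕ} (π : Equiv.Perm (Fin (a + 1 + b)))
    (h : ¬ Contains π ![3, 1, 2]) (h0 : ∀ i, i.val = a → (π i).val = 0) :
    ∃ σ τ, glue σ τ = π := by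
  rw [contains_312_iff] at h
  have hm : (π ⟨a, by omega⟩).val = 0 := h0 _ rfl
  have hpos : ∀ i : Fin (a + 1 + b), i.val ≠ a → 0 < (π i).val := by
    intro i hi
    refine Nat.pos_of_ne_zero fun hz => hi ?_
    have : i = ⟨a, by omega⟩ := π.injective (Fin.ext (by rw [hz, hm]))
    rw [this]
  have hlt : ∀ i j : Fin (a + 1 + b), i.val ≤ a → a < j.val → (π i).val < (π j).val := by
    intro i j hi hj
    have hj0 := hpos j (by omega)
    rcases Nat.lt_or_ge i.val a with hi' | hi'
    · by_contra hle
      refine h ⟨i, ⟨a, by omega⟩, j, hi', hj, ?_, ?_⟩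
      · rw [Fin.lt_def, hm]
        exact hj0
      · have : (π i).val ≠ (π j).val := fun he => by
          have := π.injective (Fin.ext he)
          rw [this] at hi
          omega
        rw [Fin.lt_def]
        omega
    · rw [h0 i (by omega)]
      exact hj0
  have hright : ∀ j : Fin (a + 1 + b), a < j.val → a + 1 ≤ (π j).val := by
    intro j hj
    refine le_of_injective_of_lt (fun i : Fin (a + 1) => (π ⟨i, by omega⟩).val) ?_
      fun i => hlt _ j (by simp only; omega) hj
    intro i i' hi
    have := Fin.ext_iff.1 (π.injective (Fin.ext hi))
    exact Fin.ext this
  have hleft : ∀ i : Fin (a + 1 + b), i.val < a → (π i).val ≤ a := by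
    intro i hi
    have hi' := (π i).isLt
    -- Reflecting values by `v ↦ a + b - v` turns the `b` larger entries on the right into `b`
    -- distinct numbers below `c`.
    have := le_of_injective_of_lt (c := a + b - (π i).val)
      (fun j : Fin b => a + b - (π ⟨j + (a + 1), by omega⟩).val) ?_ ?_
    · omega
    · intro j j' hj
      have h1 := (π ⟨j + (a + 1), by omega⟩).isLt
      have h2 := (π ⟨j' + (a + 1), by omega⟩).isLt
      have h3 := Fin.ext_iff.1 (π.injective (Fin.ext
        (show (π ⟨j + (a + 1), by omega⟩).val = (π ⟨j' + (a + 1), by omega⟩).val by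
          simp only at hj; omega)))
      simp only at h3
      exact Fin.ext (by omega)
    · intro j
      have h1 := (π ⟨j + (a + 1), by omega⟩).isLt
      have h2 := hlt i ⟨j + (a + 1), by omega⟩ hi.le (by simp only; omega)
      omega
  let f : Fin a → Fin a := fun i =>
    ⟨(π ⟨i, by omega⟩).val - 1, by
      have h1 := hleft ⟨i, by omega⟩ i.isLt
      have h2 := hpos ⟨i, by omega⟩ (by simp only; omega)
      omega⟩
  have hf : Function.Injective f := by
    intro i j hij
    have h1 := hpos ⟨i, by omega⟩ (by simp only; omega)
    have h2 := hpos ⟨j, by omega⟩ (by simp only; omega)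
    have h3 := Fin.ext_iff.1 hij
    simp only [f] at h3
    have h4 := π.injective (Fin.ext (show (π ⟨i, by omega⟩).val = (π ⟨j, by omega⟩).val by omega))
    have h5 := Fin.ext_iff.1 h4
    exact Fin.ext h5
  let g : Fin b → Fin b := fun i =>
    ⟨(π ⟨i + (a + 1), by omega⟩).val - (a + 1), by
      have h1 := hright ⟨i + (a + 1), by omega⟩ (by simp only; omega)
      omega⟩
  have hg : Function.Injective g := by
    intro i j hij
    have h1 := hright ⟨i + (a + 1), by omega⟩ (by simp only; omega)
    have h2 := hright ⟨j + (a + 1), by omega⟩ (by simp only; omega)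
    have h3 := Fin.ext_iff.1 hij
    simp only [g] at h3
    have h4 := Fin.ext_iff.1 (π.injective (Fin.ext
      (show (π ⟨i + (a + 1), by omega⟩).val = (π ⟨j + (a + 1), by omega⟩).val by omega)))
    simp only at h4
    exact Fin.ext (by omega)
  refine ⟨Equiv.ofBijective f (Finite.injective_iff_bijective.1 hf),
    Equiv.ofBijective g (Finite.injective_iff_bijective.1 hg), ?_⟩
  ext i
  rcases position_cases i with ⟨j, hj⟩ | hj | ⟨j, hj⟩
  · have hi : (⟨j, by omega⟩ : Fin (a + 1 + b)) = i := Fin.ext hj.symm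
    rw [glue_left _ _ j hj]
    have h2 := hpos ⟨j, by omega⟩ (by simp only; omega)
    simp only [Equiv.ofBijective_apply, f, hi] at h2 ⊢
    omega
  · rw [glue_mid _ _ hj, h0 i hj]
  · have hi : (⟨j + (a + 1), by omega⟩ : Fin (a + 1 + b)) = i := Fin.ext hj.symm
    rw [glue_right _ _ j hj]
    have h2 := hright ⟨j + (a + 1), by omega⟩ (by simp only; omega)
    simp only [Equiv.ofBijective_apply, g, hi] at h2 ⊢
    omega

open Classical in
theorem ncard_avoiders_fiber (P : ℕ → ℕ → Prop) {N : ℕ} (a b : ℕ) (hN : a + 1 + b = N) :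
    {π ∈ avoiders P N | ∀ i, i.val = a → (π i).val = 0}.ncard =
      if P (a + 1) 1 then cnt (fun p v => P p (v + 1)) a *
        cnt (fun p v => P (p + (a + 1)) (v + (a + 1))) b else 0 := by
  subst hN
  split_ifs with hP
  · rw [cnt, cnt, ← Set.ncard_prod]
    symm
    refine Set.ncard_congr (fun x _ => glue x.1 x.2) ?_ ?_ ?_
    · rintro ⟨σ, τ⟩ ⟨⟨h1, h2⟩, h3, h4⟩
      refine ⟨⟨(fits_glue_iff P σ τ).2 ⟨h1, hP, h3⟩, ?_⟩, fun i hi => glue_mid σ τ hi⟩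
      rw [contains_glue_iff]
      exact not_or.2 ⟨h2, h4⟩
    · rintro ⟨σ, τ⟩ ⟨σ', τ'⟩ _ _ h
      exact Prod.ext_iff.2 (glue_injective h)
    · rintro π ⟨⟨h1, h2⟩, h3⟩
      obtain ⟨σ, τ, rfl⟩ := exists_glue_eq π h2 h3
      rw [contains_glue_iff, not_or] at h2
      rw [fits_glue_iff] at h1
      exact ⟨(σ, τ), ⟨⟨h1.1, h2.1⟩, h1.2.2, h2.2⟩, rfl⟩
  · rw [Set.ncard_eq_zero]
    ext π
    simp only [Set.mem_ofPred_eq, Set.mem_empty_iff_false, iff_false]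
    rintro ⟨⟨h1, -⟩, h3⟩
    have := h1 ⟨a, by omega⟩
    rw [val, h3 _ rfl] at this
    exact hP this

open Classical in
/-- Decomposition of the `312`-avoiding permutations on a board by the position of the entry `1`. -/
theorem cnt_succ (P : ℕ → ℕ → Prop) (N : ℕ) :
    cnt P (N + 1) = ∑ x ∈ Finset.HasAntidiagonal.antidiagonal N,
      if P (x.1 + 1) 1 then cnt (fun p v => P p (v + 1)) x.1 *
        cnt (fun p v => P (p + (x.1 + 1)) (v + (x.1 + 1))) x.2 else 0 := by
  -- Each summand is a fibre of the map sending `π` to the lengths of the blocks before and after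
  -- its smallest entry.
  have key : ∀ x ∈ Finset.HasAntidiagonal.antidiagonal N,
      (if P (x.1 + 1) 1 then cnt (fun p v => P p (v + 1)) x.1 *
        cnt (fun p v => P (p + (x.1 + 1)) (v + (x.1 + 1))) x.2 else 0) =
      ((Set.toFinite (avoiders P (N + 1))).toFinset.filter
        fun π => ((π.symm 0).val, N - (π.symm 0).val) = x).card := by
    rintro ⟨a, b⟩ hx
    rw [Finset.HasAntidiagonal.mem_antidiagonal] at hx
    simp only at hx
    rw [← ncard_avoiders_fiber P a b (by omega : a + 1 + b = N + 1), ← Set.ncard_coe_finset]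
    congr 1
    ext π
    simp only [Set.mem_ofPred_eq, Finset.coe_filter, Set.Finite.mem_toFinset, Prod.mk.injEq]
    refine and_congr_right fun _ => ⟨fun h => ?_, ?_⟩
    · have : π.symm 0 = ⟨a, by omega⟩ := by
        rw [Equiv.symm_apply_eq]
        exact (Fin.ext (h _ rfl)).symm
      rw [this]
      exact ⟨rfl, by simp only; omega⟩
    · rintro ⟨h, -⟩ i hi
      have : i = π.symm 0 := Fin.ext (hi.trans h.symm)
      rw [this, Equiv.apply_symm_apply]
      rfl
  rw [Finset.sum_congr rfl key, ← Finset.card_eq_sum_card_fiberwise, cnt,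
    Set.ncard_eq_toFinset_card]
  intro π _
  have := (π.symm 0).isLt
  simp only [Finset.mem_coe, Finset.HasAntidiagonal.mem_antidiagonal]
  omega

theorem cnt_true (N : ℕ) : cnt (fun _ _ => True) N = catalan N := by
  induction N using Nat.strong_induction_on with
  | _ N ih =>
    cases N with
    | zero => rw [cnt_zero, catalan_zero]
    | succ N =>
      rw [cnt_succ, catalan_succ']
      refine Finset.sum_congr rfl fun x hx => ?_
      have hx' := Finset.HasAntidiagonal.mem_antidiagonal.1 hx
      rw [if_pos trivial, ih x.1 (by omega), ih x.2 (by omega)]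

/-! ### Parity parts of generating functions, and boards. -/

/-- The generating function of a sequence, restricted to the indices of the same parity as `e`. -/
noncomputable def partSeries (e : ℕ) (f : ℕ → ℕ) : PowerSeries ℚ :=
  PowerSeries.mk fun N => if Even (N + e) then (f N : ℚ) else 0

theorem partSeries_congr {e : ℕ} {f g : ℕ → ℕ} (h : ∀ N, Even (N + e) → f N = g N) :
    partSeries e f = partSeries e g := by
  rw [partSeries, partSeries]
  congr 1
  funext N
  split_ifs with hN
  · rw [h N hN]
  · rfl

theorem partSeries_add_two (e : ℕ) (f : ℕ → ℕ) : partSeries (e + 2) f = partSeries e f := by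
  have h (N : ℕ) : Even (N + (e + 2)) ↔ Even (N + e) := by grind
  simp only [partSeries, h]

/-- The board on which the cell `(p, v)` with `m ≤ p - v` is allowed exactly when `p + s` and
`v + t` are both even. -/
def board (m s t : ℕ) (p v : ℕ) : Prop := v + m ≤ p → Even (p + s) ∧ Even (v + t)

/-- No cell in a square of side `N` has `p - v ≥ N`, so the board imposes nothing. -/
theorem cnt_board_of_le {m s t N : ℕ} (h : N ≤ m) : cnt (board m s t) N = catalan N := by
  rw [← cnt_true]
  refine cnt_congr fun p v _ hp hv _ => ?_
  simp only [board, iff_true]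
  omega

theorem board_raise (m s t : ℕ) :
    (fun p v => board m s t p (v + 1)) = board (m + 1) s (t + 1) := by
  funext p v
  simp only [board, add_assoc, add_comm 1]

theorem board_congr (m : ℕ) {s s' t t' : ℕ} (hs : Even s ↔ Even s') (ht : Even t ↔ Even t') :
    board m s t = board m s' t' := by
  funext p v
  simp only [board, Nat.even_add, hs, ht]

theorem board_shift (m s t c : ℕ) :
    (fun p v => board m s t (p + c) (v + c)) = board m (s + c) (t + c) := by
  funext p v
  have h : v + c + m ≤ p + c ↔ v + m ≤ p := by omega
  simp only [board, h]
  rw [add_assoc, add_assoc, add_comm c, add_comm c]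

theorem board_add_even {c : ℕ} (hc : Even c) (m s t : ℕ) :
    board m (s + c) (t + c) = board m s t := by
  funext p v
  simp only [board, ← add_assoc, Nat.even_add (n := c), hc, iff_true]

open Classical in
/-- The number of fillings of the block that precedes the entry `1` in position `a + 1`. -/
noncomputable def leftCnt (m s t a : ℕ) : ℕ :=
  if board m s t (a + 1) 1 then cnt (board (m + 1) s (t + 1)) a else 0

theorem cnt_board_succ (m s t N : ℕ) :
    cnt (board m s t) (N + 1) = ∑ x ∈ Finset.HasAntidiagonal.antidiagonal N,
      leftCnt m s t x.1 * cnt (board m (s + (x.1 + 1)) (t + (x.1 + 1))) x.2 := by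
  simp only [cnt_succ, board_raise, board_shift, leftCnt, ite_mul, zero_mul]

/-- The recurrence for the even and odd parts of the generating function of a board. -/
theorem partSeries_board (m s t e : ℕ) :
    partSeries e (cnt (board m s t)) = (if Even e then 1 else 0) +
      X * partSeries 1 (leftCnt m s t) * partSeries e (cnt (board m s t)) +
      X * partSeries 0 (leftCnt m s t) *
        partSeries (e + 1) (cnt (board m (s + 1) (t + 1))) := by
  ext N
  cases N with
  | zero =>
    simp only [partSeries, map_add, mul_assoc, coeff_zero_X_mul, coeff_mk, zero_add, cnt_zero,
      add_zero, Nat.cast_one]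
    split_ifs <;> simp
  | succ N =>
    have hc : coeff (N + 1) (if Even e then (1 : PowerSeries ℚ) else 0) = 0 := by
      split_ifs <;> simp [coeff_one]
    rw [map_add, map_add, mul_assoc, mul_assoc, coeff_succ_X_mul, coeff_succ_X_mul, coeff_mul,
      coeff_mul, hc, zero_add, ← Finset.sum_add_distrib]
    have key : ∀ x ∈ Finset.HasAntidiagonal.antidiagonal N,
        coeff x.1 (partSeries 1 (leftCnt m s t)) * coeff x.2 (partSeries e (cnt (board m s t))) +
        coeff x.1 (partSeries 0 (leftCnt m s t)) *
          coeff x.2 (partSeries (e + 1) (cnt (board m (s + 1) (t + 1)))) =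
        if Even (N + 1 + e) then ((leftCnt m s t x.1 *
          cnt (board m (s + (x.1 + 1)) (t + (x.1 + 1))) x.2 : ℕ) : ℚ) else 0 := by
      rintro ⟨a, b⟩ hx
      obtain rfl : a + b = N := Finset.HasAntidiagonal.mem_antidiagonal.1 hx
      simp only [partSeries, coeff_mk]
      -- The right block is shifted by `a + 1`: for odd `a` its board and the parity class of its
      -- size are unchanged, for even `a` both switch. So only one of the two products contributes.
      rcases Nat.even_or_odd a with ha | ha
      · have h1 : board m (s + (a + 1)) (t + (a + 1)) = board m (s + 1) (t + 1) := by
          rw [add_comm a, ← add_assoc, ← add_assoc, board_add_even ha]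
        have h2 : Even (a + b + 1 + e) ↔ Even (b + (e + 1)) := by grind
        rw [h1, if_neg (show ¬ Even (a + 1) by grind), if_pos (show Even (a + 0) from ha)]
        simp only [h2, zero_mul, ite_self, zero_add, mul_ite, mul_zero, Nat.cast_mul]
      · have h1 : board m (s + (a + 1)) (t + (a + 1)) = board m s t :=
          board_add_even ha.add_one m s t
        have h2 : Even (a + b + 1 + e) ↔ Even (b + e) := by grind
        rw [h1, if_pos ha.add_one, if_neg (show ¬ Even (a + 0) by grind)]
        simp only [h2, zero_mul, ite_self, add_zero, mul_ite, mul_zero, Nat.cast_mul]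
    rw [Finset.sum_congr rfl key, partSeries, coeff_mk, cnt_board_succ]
    split_ifs
    · rw [Nat.cast_sum]
    · rw [Finset.sum_const_zero]

/-! ### Truncated Catalan series as left-block series. -/

theorem coeff_catE (k n : ℕ) :
    coeff n (catE k) = if Even n ∧ n ≤ 2 * k then (catalan n : ℚ) else 0 := by
  have h : ∀ i, (coeff n) ((catalan (2 * i) : PowerSeries ℚ) * X ^ (2 * i)) =
      if n = 2 * i then (catalan n : ℚ) else 0 := by
    intro i
    rw [← map_natCast (C (R := ℚ)), coeff_C_mul, coeff_X_pow]
    split_ifs with h <;> simp [h]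
  simp only [catE, map_sum, h]
  split_ifs with hn
  · obtain ⟨⟨j, hj⟩, hk⟩ := hn
    rw [Finset.sum_eq_single j]
    · rw [if_pos (by omega)]
    · intro i _ hi
      rw [if_neg (by omega)]
    · intro hj'
      rw [Finset.mem_range] at hj'
      omega
  · refine Finset.sum_eq_zero fun i hi => if_neg fun hi' => hn ?_
    rw [Finset.mem_range] at hi
    exact ⟨⟨i, by omega⟩, by omega⟩

theorem coeff_catO (k n : ℕ) :
    coeff n (catO k) = if Odd n ∧ n < 2 * k then (catalan n : ℚ) else 0 := by
  have h : ∀ i, (coeff n) ((catalan (2 * i + 1) : PowerSeries ℚ) * X ^ (2 * i + 1)) =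
      if n = 2 * i + 1 then (catalan n : ℚ) else 0 := by
    intro i
    rw [← map_natCast (C (R := ℚ)), coeff_C_mul, coeff_X_pow]
    split_ifs with h <;> simp [h]
  simp only [catO, map_sum, h]
  split_ifs with hn
  · obtain ⟨⟨j, hj⟩, hk⟩ := hn
    rw [Finset.sum_eq_single j]
    · rw [if_pos (by omega)]
    · intro i _ hi
      rw [if_neg (by omega)]
    · intro hj'
      rw [Finset.mem_range] at hj'
      omega
  · refine Finset.sum_eq_zero fun i hi => if_neg fun hi' => hn ?_
    rw [Finset.mem_range] at hi
    exact ⟨⟨i, by omega⟩, by omega⟩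

theorem catE_eq (k : ℕ) :
    catE k = partSeries 0 fun n => if n ≤ 2 * k then catalan n else 0 := by
  ext n
  rw [coeff_catE, partSeries, coeff_mk, add_zero, ite_and]
  split_ifs <;> simp

theorem catO_eq (k : ℕ) :
    catO k = partSeries 1 fun n => if n < 2 * k then catalan n else 0 := by
  ext n
  simp only [coeff_catO, partSeries, coeff_mk, Nat.even_add_one, Nat.not_even_iff_odd, ite_and]
  split_ifs <;> simp

theorem rSeries_eq (m : ℕ) : rSeries m = partSeries 1 (cnt (board m 0 0)) := by
  rw [rSeries, partSeries]
  congr 1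
  funext N
  simp only [Nat.even_add_one, Nat.not_even_iff_odd]
  split_ifs <;> rfl

theorem leftCnt_of_le {m s t a : ℕ} (h : a < m) : leftCnt m s t a = catalan a := by
  rw [leftCnt, if_pos (show board m s t (a + 1) 1 from fun h' => absurd h' (by omega)),
    cnt_board_of_le (by omega)]

theorem leftCnt_of_even {m s t a : ℕ} (hs : Even (a + 1 + s)) (ht : Even (1 + t)) :
    leftCnt m s t a = cnt (board (m + 1) s (t + 1)) a := if_pos fun _ => ⟨hs, ht⟩

theorem leftCnt_of_not {m s t a : ℕ} (h : m ≤ a) (h' : ¬ (Even (a + 1 + s) ∧ Even (1 + t))) :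
    leftCnt m s t a = 0 := if_neg fun hb => h' (hb (by omega))

/-- For even `a` the parity test in the bottom row fails, so only `a < m` survives; for either value
of `m` this means `a ≤ 2k`. -/
theorem partSeries_leftCnt_zero {k s t : ℕ} (h : ¬ (Even (1 + s) ∧ Even (1 + t))) {m : ℕ}
    (hm : m = 2 * k + 1 ∨ m = 2 * k + 2) : partSeries 0 (leftCnt m s t) = catE k := by
  rw [catE_eq]
  refine partSeries_congr fun a ha => ?_
  split_ifs with hk
  · exact leftCnt_of_le (by omega)
  · exact leftCnt_of_not (by grind) (by grind)

/-- For odd `a` the surviving range `a < m` amounts to `a < 2k`, for either value of `m`. -/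
theorem partSeries_leftCnt_one {k s t : ℕ} (h : ¬ (Even s ∧ Even (1 + t))) {m : ℕ}
    (hm : m = 2 * k + 1 ∨ m = 2 * k) : partSeries 1 (leftCnt m s t) = catO k := by
  rw [catO_eq]
  refine partSeries_congr fun a ha => ?_
  split_ifs with hk
  · exact leftCnt_of_le (by omega)
  · exact leftCnt_of_not (by grind) (by grind)

/-! ### The linear equations linking the boards. -/

theorem odd_board_even_even (k : ℕ) :
    partSeries 1 (cnt (board (2 * k + 1) 0 0)) =
      X * catO k * partSeries 1 (cnt (board (2 * k + 1) 0 0)) +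
      X * catE k * partSeries 0 (cnt (board (2 * k + 1) 1 1)) := by
  have h := partSeries_board (2 * k + 1) 0 0 1
  rwa [partSeries_leftCnt_zero (k := k) (by decide) (by omega),
    partSeries_leftCnt_one (k := k) (by decide) (by omega), if_neg (by decide), zero_add,
    partSeries_add_two 0] at h

theorem even_board_even_even (k : ℕ) :
    partSeries 0 (cnt (board (2 * k + 1) 0 0)) =
      1 + X * catO k * partSeries 0 (cnt (board (2 * k + 1) 0 0)) +
      X * catE k * partSeries 1 (cnt (board (2 * k + 1) 1 1)) := by
  have h := partSeries_board (2 * k + 1) 0 0 0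
  rwa [partSeries_leftCnt_zero (k := k) (by decide) (by omega),
    partSeries_leftCnt_one (k := k) (by decide) (by omega), if_pos (by decide)] at h

/-- Here the bottom row passes the parity test, so the entry 1 may follow a left block of any even
length. -/
theorem board_odd_odd_left (k : ℕ) : partSeries 0 (leftCnt (2 * k + 1) 1 1) =
    partSeries 0 (cnt (board (2 * k + 2) 1 0)) := by
  refine partSeries_congr fun a ha => ?_
  rw [leftCnt_of_even (by grind) (by decide)]
  exact congrArg (cnt · a) (board_congr _ Iff.rfl (by decide))

theorem even_board_odd_odd (k : ℕ) :
    partSeries 0 (cnt (board (2 * k + 1) 1 1)) =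
      1 + X * catO k * partSeries 0 (cnt (board (2 * k + 1) 1 1)) +
      X * partSeries 0 (cnt (board (2 * k + 2) 1 0)) *
        partSeries 1 (cnt (board (2 * k + 1) 0 0)) := by
  have h := partSeries_board (2 * k + 1) 1 1 0
  rwa [board_odd_odd_left, partSeries_leftCnt_one (k := k) (by decide) (by omega),
    if_pos (by decide), board_congr (2 * k + 1) (s := 1 + 1) (s' := 0) (t := 1 + 1) (t' := 0) (by decide) (by decide)] at h

theorem odd_board_odd_odd (k : ℕ) :
    partSeries 1 (cnt (board (2 * k + 1) 1 1)) =
      X * catO k * partSeries 1 (cnt (board (2 * k + 1) 1 1)) +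
      X * partSeries 0 (cnt (board (2 * k + 2) 1 0)) *
        partSeries 0 (cnt (board (2 * k + 1) 0 0)) := by
  have h := partSeries_board (2 * k + 1) 1 1 1
  rwa [board_odd_odd_left, partSeries_leftCnt_one (k := k) (by decide) (by omega),
    if_neg (by decide), zero_add, board_congr (2 * k + 1) (s := 1 + 1) (s' := 0) (t := 1 + 1) (t' := 0) (by decide) (by decide), partSeries_add_two 0] at h

theorem even_board_odd_even (k : ℕ) :
    partSeries 0 (cnt (board (2 * k + 2) 1 0)) =
      1 + X * catO (k + 1) * partSeries 0 (cnt (board (2 * k + 2) 1 0)) +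
      X * catE k * partSeries 1 (cnt (board (2 * k + 2) 0 1)) := by
  have h := partSeries_board (2 * k + 2) 1 0 0
  rwa [partSeries_leftCnt_zero (k := k) (by decide) (by omega),
    partSeries_leftCnt_one (k := k + 1) (by decide) (by omega), if_pos (by decide),
    board_congr (2 * k + 2) (s := 1 + 1) (s' := 0) (t := 0 + 1) (t' := 1) (by decide) (by decide)] at h

theorem odd_board_even_odd (k : ℕ) :
    partSeries 1 (cnt (board (2 * k + 2) 0 1)) =
      X * partSeries 1 (cnt (board (2 * (k + 1) + 1) 0 0)) *
        partSeries 1 (cnt (board (2 * k + 2) 0 1)) +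
      X * catE k * partSeries 0 (cnt (board (2 * k + 2) 1 0)) := by
  have h := partSeries_board (2 * k + 2) 0 1 1
  -- The passage to the next level: raising the left block by one row restores the original parities
  -- with parameter `2k + 3`.
  have hl : partSeries 1 (leftCnt (2 * k + 2) 0 1) =
      partSeries 1 (cnt (board (2 * (k + 1) + 1) 0 0)) := by
    refine partSeries_congr fun a ha => ?_
    rw [leftCnt_of_even ha (by decide)]
    exact congrArg (cnt · a) (board_congr _ Iff.rfl (by decide))
  rwa [partSeries_leftCnt_zero (k := k) (by decide) (by omega), hl, if_neg (by decide), zero_add,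
    partSeries_add_two 0, board_congr (2 * k + 2) (s := 0 + 1) (s' := 1) (t := 1 + 1) (t' := 0) (by decide) (by decide)] at h

/-! ### The continued fraction and its uniqueness. -/

theorem rSeries_recurrence : SatisfiesRecurrence fun k => rSeries (2 * k + 1) := by
  intro k
  simp only [rSeries_eq]
  have h1 := odd_board_even_even k
  have h2 := even_board_odd_odd k
  have h3 := even_board_odd_even k
  have h4 := odd_board_even_odd k
  set a := partSeries 1 (cnt (board (2 * k + 1) 0 0))
  set b := partSeries 0 (cnt (board (2 * k + 1) 1 1))
  set d := partSeries 0 (cnt (board (2 * k + 2) 1 0))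
  set e := partSeries 1 (cnt (board (2 * k + 2) 0 1))
  set r := partSeries 1 (cnt (board (2 * (k + 1) + 1) 0 0))
  have u1 : (1 - X * r) * (1 - X * r)⁻¹ = 1 := PowerSeries.mul_inv_cancel _ (by simp)
  have he : e = X * catE k * d * (1 - X * r)⁻¹ := by
    linear_combination (1 - X * r)⁻¹ * h4 - e * u1
  have hd : (1 - X * catO (k + 1) - X ^ 2 * catE k ^ 2 * (1 - X * r)⁻¹) * d = 1 := by
    rw [he] at h3
    linear_combination h3
  rw [(PowerSeries.eq_inv_iff_mul_eq_one (by simp)).2 ((mul_comm _ _).trans hd) |>.symm,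
    PowerSeries.eq_mul_inv_iff_mul_eq (by simp)]
  -- Eliminates `b` from `(1 - X * catO k) * a = X * catE k * b` and `(1 - X * catO k) * b = 1 + X *
  -- d * a`.
  linear_combination X * (1 - X * catO k) * h1 + X ^ 2 * catE k * h2

theorem X_pow_dvd_inv_sub_inv {n : ℕ} {u v : PowerSeries ℚ} (hu : constantCoeff u ≠ 0)
    (hv : constantCoeff v ≠ 0) (h : X ^ n ∣ u - v) : X ^ n ∣ u⁻¹ - v⁻¹ := by
  have h1 := PowerSeries.mul_inv_cancel u hu
  have h2 := PowerSeries.mul_inv_cancel v hv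
  have : u⁻¹ - v⁻¹ = (u - v) * (- (u⁻¹ * v⁻¹)) := by
    linear_combination v⁻¹ * h1 - u⁻¹ * h2
  rw [this]
  exact h.mul_right _

/-- If two solutions agree modulo `X ^ n` at level `k + 1`, they agree modulo `X ^ (n + 1)` at level
`k`; the induction on `n` therefore treats all levels at once. -/
theorem SatisfiesRecurrence.unique {F G : ℕ → PowerSeries ℚ} (hF : SatisfiesRecurrence F)
    (hG : SatisfiesRecurrence G) : F = G := by
  have key : ∀ n k, (X : PowerSeries ℚ) ^ n ∣ F k - G k := by
    intro n
    induction n with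
    | zero => intro k; simp
    | succ n ih =>
      intro k
      have h1 : (X : PowerSeries ℚ) ^ n ∣ (1 - X * F (k + 1)) - (1 - X * G (k + 1)) := by
        have := (ih (k + 1)).mul_right (-X)
        rwa [show (F (k + 1) - G (k + 1)) * -X = (1 - X * F (k + 1)) - (1 - X * G (k + 1)) by ring]
          at this
      have h2 := X_pow_dvd_inv_sub_inv (by simp) (by simp) h1
      have h3 : (X : PowerSeries ℚ) ^ n ∣
          (1 - X * catO (k + 1) - X ^ 2 * catE k ^ 2 * (1 - X * F (k + 1))⁻¹) -
          (1 - X * catO (k + 1) - X ^ 2 * catE k ^ 2 * (1 - X * G (k + 1))⁻¹) := by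
        convert h2.mul_right (-(X ^ 2 * catE k ^ 2)) using 1
        ring
      have h4 := X_pow_dvd_inv_sub_inv (by simp) (by simp) h3
      set p := (1 - X * catO (k + 1) - X ^ 2 * catE k ^ 2 * (1 - X * F (k + 1))⁻¹)⁻¹
      set q := (1 - X * catO (k + 1) - X ^ 2 * catE k ^ 2 * (1 - X * G (k + 1))⁻¹)⁻¹
      have h5 : (X : PowerSeries ℚ) ^ n ∣
          ((1 - X * catO k) ^ 2 - X ^ 2 * catE k * p) -
          ((1 - X * catO k) ^ 2 - X ^ 2 * catE k * q) := by
        convert h4.mul_right (-(X ^ 2 * catE k)) using 1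
        ring
      have h6 := X_pow_dvd_inv_sub_inv (by simp) (by simp) h5
      have h7 : X * (F k - G k) = X ^ 2 * catE k * (((1 - X * catO k) ^ 2 - X ^ 2 * catE k * p)⁻¹ -
          ((1 - X * catO k) ^ 2 - X ^ 2 * catE k * q)⁻¹) := by
        rw [mul_sub, hF k, hG k]
        ring
      rw [← mul_dvd_mul_iff_left (X_ne_zero (R := ℚ)), h7]
      obtain ⟨w, hw⟩ := h6
      -- The factor `X ^ 2` on the right against `X` on the left supplies the extra power.
      exact ⟨catE k * w, by rw [hw]; ring⟩
  funext k
  refine sub_eq_zero.1 ?_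
  ext n
  exact X_pow_dvd_iff.1 (key (n + 1) k) n (Nat.lt_succ_self n)

/-! ### Identification of `R_1` with the Dumont series. -/

theorem odd_eq_X_mul_even :
    partSeries 1 (cnt (board 1 0 0)) = X * partSeries 0 (cnt (board 1 0 0)) := by
  have h1 := odd_board_even_even 0
  have h2 := even_board_odd_odd 0
  have h3 := even_board_even_even 0
  have h4 := odd_board_odd_odd 0
  have hE : catE 0 = 1 := by simp [catE]
  have hO : catO 0 = 0 := by simp [catO]
  simp only [hE, hO, mul_zero, zero_mul, zero_add, mul_one, add_zero] at h1 h2 h3 h4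
  set a := partSeries 1 (cnt (board 1 0 0))
  set a' := partSeries 0 (cnt (board 1 0 0))
  set b := partSeries 0 (cnt (board 1 1 1))
  set b' := partSeries 1 (cnt (board 1 1 1))
  set d := partSeries 0 (cnt (board 2 1 0))
  have hu : (1 - X ^ 2 * d : PowerSeries ℚ) ≠ 0 := fun h => by
    have := congrArg constantCoeff h
    simp at this
  refine mul_left_cancel₀ hu ?_
  -- Both `a` and `X * a'` solve `y = X + X ^ 2 * d * y`.
  linear_combination h1 + X * h2 - X * h3 - X ^ 2 * h4

theorem rSeries_one_eq :
    rSeries 1 = X * expand 2 two_ne_zero (dumont4Series ![3, 1, 2]) := by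
  rw [rSeries_eq, odd_eq_X_mul_even]
  congr 1
  ext N
  simp only [coeff_expand, partSeries, coeff_mk, add_zero, even_iff_two_dvd]
  split_ifs with h
  · obtain ⟨n, rfl⟩ := h
    rw [Nat.mul_div_cancel_left n two_pos, dumont4Series, coeff_mk, cnt]
    -- On naturals `v < p` unfolds to `v + 1 ≤ p`, so the Dumont condition is literally `board 1 0
    -- 0`.
    rfl
  · rfl

end Dumont

theorem mainTheorem3 :
    (∀ n : ℕ, Dumont.dumont4Avoiding n ![1, 4, 2, 3] = Dumont.dumont4Avoiding n ![3, 1, 2]) ∧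
    Dumont.rSeries 1 =
      PowerSeries.X * PowerSeries.expand 2 two_ne_zero (Dumont.dumont4Series ![1, 4, 2, 3]) ∧
    Dumont.SatisfiesRecurrence (fun k => Dumont.rSeries (2 * k + 1)) ∧
    (∀ F : ℕ → PowerSeries ℚ, Dumont.SatisfiesRecurrence F →
      ∀ k : ℕ, F k = Dumont.rSeries (2 * k + 1)) := by
  refine ⟨Dumont.dumont4Avoiding_1423_eq, ?_, Dumont.rSeries_recurrence,
    fun F hF k => congrFun (hF.unique Dumont.rSeries_recurrence) k⟩
  rw [Dumont.rSeries_one_eq]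
  simp only [Dumont.dumont4Series, Dumont.dumont4Avoiding_1423_eq]
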